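/- Let $n\ge 2$ be an integer, $\lambda=\frac{n-1}{2}$, let $\mathcal S^n\subset\mathbb R^{n+1}$ be the unit sphere with its rotation-invariant surface measure $\sigma$ of total mass $2\pi^{\lambda+1}/\Gamma(\lambda+1)$, and let $\Delta^\ast$ be the Laplace--Beltrami operator on $\mathcal S^n$. For a $\mathcal C^2$-function $f:\mathcal S^n\to\mathbb C$ with $\int_{\mathcal S^n}x\,|f(x)|^2\,d\sigma(x)\neq 0$ in $\mathbb R^{n+1}$ put $$\mathrm{var}_S(f)=\left(\frac{\int_{\mathcal S^n}|f(x)|^2\,d\sigma(x)}{\left\|\int_{\mathcal S^n}x\,|f(x)|^2\,d\sigma(x)\right\|}\right)^2-1,\qquad \mathrm{var}_M(f)=-\frac{\int_{\mathcal S^n}\Delta^\ast f(x)\,\overline{f(x)}\,d\sigma(x)}{\int_{\mathcal S^n}|f(x)|^2\,d\sigma(x)}.$$ Let $C_l^\lambda$ be the Gegenbauer polynomials, defined by $\sum_{l\ge0}C_l^\lambda(t)\,r^l=(1-2tr+r^2)^{-\lambda}$. For an integer $m\ge1$ and a constant $C(m)\in\mathbb C\setminus\{0\}$ define the zonal function $$\Phi_m(x)=C(m)\sum_{l=0}^m\frac{l+\lambda}{\lambda}\,C_l^\lambda(x_1),\qquad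 x=(x_1,\dots,x_{n+1})\in\mathcal S^n.$$ **Proposition.** The function $\Phi_m$ is of class $\mathcal C^2$ on $\mathcal S^n$, $\int_{\mathcal S^n}x\,|\Phi_m(x)|^2\,d\sigma(x)\ne0$, and $$\mathrm{var}_S(\Phi_m)=\left(\frac{2m+2\lambda+1}{2m}\right)^2-1,\qquad \mathrm{var}_M(\Phi_m)=\frac{m\,(m+2\lambda+1)\,(2\lambda+1)}{2\lambda+3}.$$ -/

import Mathlib

open MeasureTheory
open scoped Manifold ComplexConjugate

noncomputable section

/-- The Euclidean space `ℝ^{n+1}`. -/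
abbrev Ambient (n : ℕ) : Type := EuclideanSpace ℝ (Fin (n + 1))

/-- The unit sphere `S^n` in `ℝ^{n+1}`. -/
abbrev UnitSphere (n : ℕ) : Type := Metric.sphere (0 : Ambient n) 1

/-- The rotation-invariant surface measure `σ` on `S^n`, of total mass
`2 π^((n+1)/2) / Γ((n+1)/2)`. -/
def surfaceMeasure (n : ℕ) : Measure (UnitSphere n) :=
  (volume : Measure (Ambient n)).toSphere

/-- The Gegenbauer polynomial `C_l^lam(t)`: the coefficient of `r^l` in the expansion at `r = 0` of
the generating function `(1 - 2 t r + r^2)^(-lam)`. -/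
def gegenbauer (lam : ℝ) (l : ℕ) (t : ℝ) : ℝ :=
  iteratedDeriv l (fun r : ℝ => (1 - 2 * t * r + r ^ 2) ^ (-lam)) 0 / (l.factorial : ℝ)

/-- The extension of a function on `S^n` that is constant along rays from the origin, that is
`y ↦ f (y / ‖y‖)` for `y ≠ 0` (with the value `0` at the origin). -/
def radialExtension {n : ℕ} (f : UnitSphere n → ℂ) (y : Ambient n) : ℂ :=
  if hy : y = 0 then 0
  else f ⟨‖y‖⁻¹ • y, by
    rw [mem_sphere_zero_iff_norm]
    exact norm_smul_inv_norm (𝕜 := ℝ) hy⟩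

/-- The Laplace--Beltrami operator on `S^n`: the restriction to the sphere of the Euclidean
Laplacian of the extension that is constant along rays. -/
def laplaceBeltrami {n : ℕ} (f : UnitSphere n → ℂ) (x : UnitSphere n) : ℂ :=
  Laplacian.laplacian (radialExtension f) (x : Ambient n)

/-- The vector `∫ x |f(x)|^2 dσ(x)` in `ℝ^{n+1}`. -/
def firstMoment {n : ℕ} (f : UnitSphere n → ℂ) : Ambient n :=
  ∫ x : UnitSphere n, (‖f x‖ ^ 2) • (x : Ambient n) ∂(surfaceMeasure n)

/-- The variance in the space domain; the square of the vector in the denominator is the square of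
its Euclidean norm. -/
def varSpace {n : ℕ} (f : UnitSphere n → ℂ) : ℝ :=
  ((∫ x : UnitSphere n, ‖f x‖ ^ 2 ∂(surfaceMeasure n)) / ‖firstMoment f‖) ^ 2 - 1

/-- The variance in the momentum domain (a priori a complex number). -/
def varMomentum {n : ℕ} (f : UnitSphere n → ℂ) : ℂ :=
  -((∫ x : UnitSphere n, laplaceBeltrami f x * conj (f x) ∂(surfaceMeasure n)) /
    ((∫ x : UnitSphere n, ‖f x‖ ^ 2 ∂(surfaceMeasure n) : ℝ) : ℂ))

/-- The zonal function `x ↦ c * ∑_{l=0}^m (l+lam)/lam * C_l^lam(x_1)` on `S^n`, `lam = (n-1)/2`,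
where `x_1 = ⟨e, x⟩` is the coordinate along the north pole `e = (1,0,…,0)`. -/
def scalingKernel (n m : ℕ) (c : ℂ) (x : UnitSphere n) : ℂ :=
  let lam : ℝ := ((n : ℝ) - 1) / 2
  c * ((∑ l ∈ Finset.range (m + 1),
    ((l : ℝ) + lam) / lam * gegenbauer lam l ((x : Ambient n) 0) : ℝ) : ℂ)

instance ambient_finrank_fact (n : ℕ) : Fact (Module.finrank ℝ (Ambient n) = n + 1) :=
  ⟨finrank_euclideanSpace_fin⟩

end

/-! Write `K` for the kernel polynomial `gegenbauerKernel lam m`, `E` for `ultrasphericalOp lam`,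
and `L p` for the integral of `p(x_1)` over the sphere. On zonal functions the Laplace–Beltrami
operator acts as `E`, so up to the common factor `‖c‖ ^ 2` both variances depend only on `L (K *
K)`, `L (X * K * K)` and `L (K * E K)`; the first moment points along the pole, the other
coordinates having zero integral.

These numbers follow algebraically from one property of `L`, integration by parts for the weight `(1
- t²)^(lam - 1/2)` (`IsUltraspherical`). It makes `E` symmetric, so its eigenvectors, the Gegenbauer
polynomials, are orthogonal; with the three-term recurrence this gives recursions in `m` for all
three quantities. `IsUltraspherical.kernel_closed_form` solves them as rational multiples of `L (C_m
* C_m)`, where `C_m` is the Gegenbauer polynomial. This factor cancels in both quotients, so only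
its positivity matters.

It remains to link algebra and analysis: `gegenbauer_eq_eval` (generating function against
recurrence), `sphereFunctional_isUltraspherical` (sphere moments) and `laplaceBeltrami_zonal`. -/

open Polynomial in
/-- The Gegenbauer polynomials as elements of `ℝ[X]`, defined by the three-term recurrence. -/
noncomputable def gegenbauerPoly (lam : ℝ) : ℕ → ℝ[X]
  | 0 => 1
  | 1 => 2 * C lam * X
  | l + 2 => C ((l + 2 : ℝ)⁻¹) * (2 * ((l : ℝ[X]) + 1 + C lam) * X * gegenbauerPoly lam (l + 1)
      - ((l : ℝ[X]) + 2 * C lam) * gegenbauerPoly lam l)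

/-! ### Algebra of Gegenbauer polynomials and ultraspherical functionals. -/

section Gegenbauer

open Polynomial

lemma gegenbauerPoly_recurrence (lam : ℝ) (l : ℕ) :
    ((l : ℝ[X]) + 2) * gegenbauerPoly lam (l + 2) =
      2 * ((l : ℝ[X]) + 1 + C lam) * X * gegenbauerPoly lam (l + 1)
      - ((l : ℝ[X]) + 2 * C lam) * gegenbauerPoly lam l := by
  have h : ((l : ℝ[X]) + 2) * C ((l + 2 : ℝ)⁻¹) = 1 := by
    have h1 : ((l : ℝ[X]) + 2) = C (l + 2 : ℝ) := by simp [map_ofNat C]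
    rw [h1, ← C_mul, mul_inv_cancel₀ (by positivity), C_1]
  rw [gegenbauerPoly, ← mul_assoc, h, one_mul]

lemma natCast_add_two_ne_zero_poly (l : ℕ) : ((l : ℝ[X]) + 2) ≠ 0 := by
  exact_mod_cast (by omega : l + 2 ≠ 0)

/-- The two relations are proved by a joint induction: differentiating the recurrence and inserting
the second gives the next first one, which in turn yields the next second one. -/
lemma derivative_gegenbauerPoly_succ (lam : ℝ) (l : ℕ) :
    derivative (gegenbauerPoly lam (l + 1)) = X * derivative (gegenbauerPoly lam l) +
        ((l : ℝ[X]) + 2 * C lam) * gegenbauerPoly lam l ∧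
      X * derivative (gegenbauerPoly lam (l + 1)) = derivative (gegenbauerPoly lam l) +
        ((l : ℝ[X]) + 1) * gegenbauerPoly lam (l + 1) := by
  induction l with
  | zero =>
    simp [gegenbauerPoly]
    ring
  | succ l ih =>
    obtain ⟨h1, h2⟩ := ih
    have hr := gegenbauerPoly_recurrence lam l
    have hd := congrArg derivative hr
    simp only [derivative_mul, derivative_add, derivative_sub, derivative_natCast, derivative_C,
      derivative_X, derivative_ofNat, derivative_one] at hd
    have h3 : derivative (gegenbauerPoly lam (l + 2)) =
        X * derivative (gegenbauerPoly lam (l + 1)) +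
        (((l + 1 : ℕ) : ℝ[X]) + 2 * C lam) * gegenbauerPoly lam (l + 1) := by
      apply mul_left_cancel₀ (natCast_add_two_ne_zero_poly l)
      push_cast
      linear_combination hd + ((l : ℝ[X]) + 2 * C lam) * h2
    refine ⟨h3, ?_⟩
    rw [h3]
    push_cast
    linear_combination -hr - h1 + X * h2

/-- The ultraspherical differential operator `p ↦ (1 - X²) p'' - (2 lam + 1) X p'`. -/
noncomputable def ultrasphericalOp (lam : ℝ) (p : ℝ[X]) : ℝ[X] :=
  (1 - X ^ 2) * derivative (derivative p) - (2 * C lam + 1) * X * derivative p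

lemma ultrasphericalOp_gegenbauerPoly (lam : ℝ) (l : ℕ) :
    ultrasphericalOp lam (gegenbauerPoly lam l) =
      -((l : ℝ[X]) * ((l : ℝ[X]) + 2 * C lam)) * gegenbauerPoly lam l := by
  cases l with
  | zero => simp [gegenbauerPoly, ultrasphericalOp]
  | succ l =>
    obtain ⟨h1, h2⟩ := derivative_gegenbauerPoly_succ lam l
    -- The derivative of the lower polynomial is eliminated between the two relations. One more
    -- differentiation brings it back, and `h2` removes it again.
    have h3 : (1 - X ^ 2) * derivative (gegenbauerPoly lam (l + 1)) =
        ((l : ℝ[X]) + 2 * C lam) * gegenbauerPoly lam l -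
        ((l : ℝ[X]) + 1) * X * gegenbauerPoly lam (l + 1) := by
      linear_combination h1 - X * h2
    have hd := congrArg derivative h3
    simp only [derivative_mul, derivative_add, derivative_sub, derivative_natCast, derivative_C,
      derivative_X, derivative_ofNat, derivative_one, derivative_X_pow] at hd
    rw [ultrasphericalOp]
    push_cast at hd ⊢
    simp only [map_ofNat] at hd
    linear_combination hd - ((l : ℝ[X]) + 2 * C lam) * h2

lemma ultrasphericalOp_add (lam : ℝ) (p q : ℝ[X]) :
    ultrasphericalOp lam (p + q) = ultrasphericalOp lam p + ultrasphericalOp lam q := by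
  simp only [ultrasphericalOp, derivative_add]
  ring

lemma ultrasphericalOp_C_mul (lam a : ℝ) (p : ℝ[X]) :
    ultrasphericalOp lam (C a * p) = C a * ultrasphericalOp lam p := by
  simp only [ultrasphericalOp, derivative_C_mul]
  ring

/-- `∑_{l ≤ m} (l + lam) / lam * C_l^lam` as a polynomial. -/
noncomputable def gegenbauerKernel (lam : ℝ) (m : ℕ) : ℝ[X] :=
  ∑ l ∈ Finset.range (m + 1), C ((l + lam) / lam) * gegenbauerPoly lam l

lemma gegenbauerKernel_succ (lam : ℝ) (m : ℕ) :
    gegenbauerKernel lam (m + 1) = gegenbauerKernel lam m +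
      C (((m + 1 : ℕ) + lam) / lam) * gegenbauerPoly lam (m + 1) := by
  rw [gegenbauerKernel, Finset.sum_range_succ]
  rfl

/-- A linear functional on `ℝ[X]` of the form `p ↦ ∫ p(t) (1 - t²)^(lam - 1/2) dt`,
characterized by integration by parts. -/
def IsUltraspherical (lam : ℝ) (L : ℝ[X] →ₗ[ℝ] ℝ) : Prop :=
  ∀ g : ℝ[X], L ((1 - X ^ 2) * derivative g - (2 * C lam + 1) * X * g) = 0

variable {lam : ℝ} {L : ℝ[X] →ₗ[ℝ] ℝ}

lemma map_C_mul_poly (L : ℝ[X] →ₗ[ℝ] ℝ) (a : ℝ) (p : ℝ[X]) : L (C a * p) = a * L p := by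
  rw [← smul_eq_C_mul, map_smul, smul_eq_mul]

lemma IsUltraspherical.symm (hL : IsUltraspherical lam L) (p q : ℝ[X]) :
    L (p * ultrasphericalOp lam q) = L (q * ultrasphericalOp lam p) := by
  -- The test polynomial is the Wronskian of `p` and `q`.
  rw [← sub_eq_zero, ← map_sub, ← hL (p * derivative q - q * derivative p)]
  congr 1
  simp only [ultrasphericalOp, derivative_sub, derivative_mul]
  ring

lemma IsUltraspherical.orthogonal (hL : IsUltraspherical lam L) (hlam : 0 < lam) {k l : ℕ}
    (hkl : k ≠ l) : L (gegenbauerPoly lam k * gegenbauerPoly lam l) = 0 := by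
  have h := hL.symm (gegenbauerPoly lam k) (gegenbauerPoly lam l)
  rw [ultrasphericalOp_gegenbauerPoly, ultrasphericalOp_gegenbauerPoly] at h
  have e1 : gegenbauerPoly lam k * (-((l : ℝ[X]) * (l + 2 * C lam)) * gegenbauerPoly lam l) =
      C (-(l * (l + 2 * lam) : ℝ)) * (gegenbauerPoly lam k * gegenbauerPoly lam l) := by
    simp [map_ofNat C]; ring
  have e2 : gegenbauerPoly lam l * (-((k : ℝ[X]) * (k + 2 * C lam)) * gegenbauerPoly lam k) =
      C (-(k * (k + 2 * lam) : ℝ)) * (gegenbauerPoly lam k * gegenbauerPoly lam l) := by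
    simp [map_ofNat C]; ring
  rw [e1, e2, map_C_mul_poly, map_C_mul_poly] at h
  have h2 : ((k : ℝ) - l) * ((k + l + 2 * lam) *
      L (gegenbauerPoly lam k * gegenbauerPoly lam l)) = 0 := by linear_combination h
  have h3 : ((k : ℝ) - l) ≠ 0 := sub_ne_zero.2 (by exact_mod_cast hkl)
  have h4 : ((k : ℝ) + l + 2 * lam) ≠ 0 := by positivity
  simpa [h3, h4] using h2

lemma X_mul_gegenbauerPoly (lam : ℝ) (l : ℕ) (q : ℝ[X]) (L : ℝ[X] →ₗ[ℝ] ℝ) :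
    2 * ((l : ℝ) + 1 + lam) * L (X * gegenbauerPoly lam (l + 1) * q) =
      (l + 2) * L (gegenbauerPoly lam (l + 2) * q) +
      (l + 2 * lam) * L (gegenbauerPoly lam l * q) := by
  rw [← map_C_mul_poly, ← map_C_mul_poly, ← map_C_mul_poly, ← map_add]
  congr 1
  have := gegenbauerPoly_recurrence lam l
  simp only [C_mul, C_add, C_1, map_natCast, map_ofNat]
  linear_combination (-q) * this

lemma X_mul_gegenbauerPoly_zero (lam : ℝ) (q : ℝ[X]) (L : ℝ[X] →ₗ[ℝ] ℝ) :
    2 * lam * L (X * gegenbauerPoly lam 0 * q) = L (gegenbauerPoly lam 1 * q) := by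
  rw [← map_C_mul_poly]
  congr 1
  simp [gegenbauerPoly, mul_assoc, map_ofNat C]

/-- By the recurrence, multiplication by `X` only reaches the neighbouring degrees; in particular
the diagonal entries `k = l` vanish. -/
lemma IsUltraspherical.X_mul_eq_zero (hL : IsUltraspherical lam L) (hlam : 0 < lam) {k l : ℕ}
    (h1 : k ≠ l + 1) (h2 : l ≠ k + 1) :
    L (X * gegenbauerPoly lam l * gegenbauerPoly lam k) = 0 := by
  cases l with
  | zero =>
    have h := X_mul_gegenbauerPoly_zero lam (gegenbauerPoly lam k) L
    rw [hL.orthogonal hlam h1.symm] at h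
    simpa [hlam.ne'] using h
  | succ l =>
    have h := X_mul_gegenbauerPoly lam l (gegenbauerPoly lam k) L
    rw [hL.orthogonal hlam h1.symm, hL.orthogonal hlam (by omega)] at h
    have : 2 * ((l : ℝ) + 1 + lam) ≠ 0 := by positivity
    simpa [this] using h

lemma IsUltraspherical.X_mul_succ (hL : IsUltraspherical lam L) (hlam : 0 < lam) (l : ℕ) :
    2 * ((l : ℝ) + 1 + lam) * L (X * gegenbauerPoly lam (l + 1) * gegenbauerPoly lam l) =
      (l + 2 * lam) * L (gegenbauerPoly lam l * gegenbauerPoly lam l) := by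
  rw [X_mul_gegenbauerPoly, hL.orthogonal hlam (by omega), mul_zero, zero_add]

/-- The mixed term `L (X * C_(l+1) * C_l)` is evaluated twice, applying the recurrence to `X *
C_(l+1)` and to `X * C_l`. -/
lemma IsUltraspherical.normSq_succ (hL : IsUltraspherical lam L) (hlam : 0 < lam) (l : ℕ) :
    ((l : ℝ) + 1) * (l + 1 + lam) * L (gegenbauerPoly lam (l + 1) * gegenbauerPoly lam (l + 1)) =
      (l + lam) * (l + 2 * lam) * L (gegenbauerPoly lam l * gegenbauerPoly lam l) := by
  have h1 := hL.X_mul_succ hlam l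
  have h2 : 2 * ((l : ℝ) + lam) * L (X * gegenbauerPoly lam l * gegenbauerPoly lam (l + 1)) =
      (l + 1) * L (gegenbauerPoly lam (l + 1) * gegenbauerPoly lam (l + 1)) := by
    cases l with
    | zero => simpa using X_mul_gegenbauerPoly_zero lam (gegenbauerPoly lam 1) L
    | succ l =>
      have h := X_mul_gegenbauerPoly lam l (gegenbauerPoly lam (l + 2)) L
      rw [hL.orthogonal hlam (show l ≠ l + 2 by omega), mul_zero, add_zero] at h
      push_cast
      linear_combination h
  have h3 : X * gegenbauerPoly lam l * gegenbauerPoly lam (l + 1) =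
      X * gegenbauerPoly lam (l + 1) * gegenbauerPoly lam l := by ring
  rw [h3] at h2
  linear_combination (l + lam) * h1 - (l + 1 + lam) * h2

lemma IsUltraspherical.normSq_pos (hL : IsUltraspherical lam L) (hlam : 0 < lam)
    (h0 : 0 < L 1) (l : ℕ) : 0 < L (gegenbauerPoly lam l * gegenbauerPoly lam l) := by
  induction l with
  | zero => simpa [gegenbauerPoly] using h0
  | succ l ih =>
    have h := hL.normSq_succ hlam l
    have h1 : 0 < (l + lam) * (l + 2 * lam) * L (gegenbauerPoly lam l * gegenbauerPoly lam l) := by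
      positivity
    rw [← h] at h1
    exact (pos_iff_pos_of_mul_pos h1).1 (by positivity)

lemma IsUltraspherical.kernel_mul (hL : IsUltraspherical lam L) (hlam : 0 < lam) {m l : ℕ}
    (h : m < l) : L (gegenbauerKernel lam m * gegenbauerPoly lam l) = 0 := by
  rw [gegenbauerKernel, Finset.sum_mul, map_sum]
  refine Finset.sum_eq_zero fun k hk => ?_
  rw [mul_assoc, map_C_mul_poly, hL.orthogonal hlam (by have := Finset.mem_range.1 hk; omega),
    mul_zero]

lemma IsUltraspherical.X_mul_kernel_mul (hL : IsUltraspherical lam L) (hlam : 0 < lam) (m : ℕ) :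
    2 * (m + 1 + lam) * L (X * gegenbauerPoly lam (m + 1) * gegenbauerKernel lam m) =
      (m + lam) / lam * ((m + 2 * lam) * L (gegenbauerPoly lam m * gegenbauerPoly lam m)) := by
  have : L (X * gegenbauerPoly lam (m + 1) * gegenbauerKernel lam m) =
      (m + lam) / lam * L (X * gegenbauerPoly lam (m + 1) * gegenbauerPoly lam m) := by
    rw [gegenbauerKernel, Finset.mul_sum, map_sum, Finset.sum_eq_single m]
    · rw [mul_left_comm, map_C_mul_poly]
    · intro k hk hkm
      have := Finset.mem_range.1 hk
      rw [mul_left_comm, map_C_mul_poly, hL.X_mul_eq_zero hlam (by omega) (by omega), mul_zero]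
    · simp
  rw [this, ← hL.X_mul_succ hlam m]
  ring

lemma IsUltraspherical.normSq_kernel_succ (hL : IsUltraspherical lam L) (hlam : 0 < lam) (m : ℕ) :
    L (gegenbauerKernel lam (m + 1) * gegenbauerKernel lam (m + 1)) =
      L (gegenbauerKernel lam m * gegenbauerKernel lam m) +
      ((m + 1 + lam) / lam) ^ 2 * L (gegenbauerPoly lam (m + 1) * gegenbauerPoly lam (m + 1)) := by
  have h := hL.kernel_mul hlam (Nat.lt_succ_self m)
  have e : gegenbauerKernel lam (m + 1) * gegenbauerKernel lam (m + 1) =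
      gegenbauerKernel lam m * gegenbauerKernel lam m +
      C (2 * ((m + 1 + lam) / lam)) * (gegenbauerKernel lam m * gegenbauerPoly lam (m + 1)) +
      C (((m + 1 + lam) / lam) ^ 2) *
        (gegenbauerPoly lam (m + 1) * gegenbauerPoly lam (m + 1)) := by
    rw [gegenbauerKernel_succ]
    push_cast
    simp only [C_mul, C_pow, map_ofNat]
    ring
  rw [e, map_add, map_add, map_C_mul_poly, map_C_mul_poly, h]
  ring

lemma IsUltraspherical.X_mul_kernel_succ (hL : IsUltraspherical lam L) (hlam : 0 < lam) (m : ℕ) :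
    L (X * gegenbauerKernel lam (m + 1) * gegenbauerKernel lam (m + 1)) =
      L (X * gegenbauerKernel lam m * gegenbauerKernel lam m) +
      (m + lam) * (m + 2 * lam) / lam ^ 2 *
        L (gegenbauerPoly lam m * gegenbauerPoly lam m) := by
  have h := hL.X_mul_kernel_mul hlam m
  have h0 := hL.X_mul_eq_zero hlam (show m + 1 ≠ m + 1 + 1 by omega) (by omega)
  have e : X * gegenbauerKernel lam (m + 1) * gegenbauerKernel lam (m + 1) =
      X * gegenbauerKernel lam m * gegenbauerKernel lam m +
      C (2 * ((m + 1 + lam) / lam)) * (X * gegenbauerPoly lam (m + 1) * gegenbauerKernel lam m) +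
      C (((m + 1 + lam) / lam) ^ 2) *
        (X * gegenbauerPoly lam (m + 1) * gegenbauerPoly lam (m + 1)) := by
    rw [gegenbauerKernel_succ]
    push_cast
    simp only [C_mul, C_pow, map_ofNat]
    ring
  rw [e, map_add, map_add, map_C_mul_poly, map_C_mul_poly, h0]
  field_simp at h ⊢
  linear_combination h

/-- Both cross terms vanish: one by orthogonality, the other after moving the operator across by
symmetry. -/
lemma IsUltraspherical.op_kernel_succ (hL : IsUltraspherical lam L) (hlam : 0 < lam) (m : ℕ) :
    L (gegenbauerKernel lam (m + 1) * ultrasphericalOp lam (gegenbauerKernel lam (m + 1))) =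
      L (gegenbauerKernel lam m * ultrasphericalOp lam (gegenbauerKernel lam m)) -
      (m + 1) * (m + 1 + 2 * lam) * (((m + 1 + lam) / lam) ^ 2 *
        L (gegenbauerPoly lam (m + 1) * gegenbauerPoly lam (m + 1))) := by
  have h := hL.kernel_mul hlam (Nat.lt_succ_self m)
  have hs := hL.symm (gegenbauerPoly lam (m + 1)) (gegenbauerKernel lam m)
  have hE : ultrasphericalOp lam (gegenbauerPoly lam (m + 1)) =
      C (-((m + 1) * (m + 1 + 2 * lam) : ℝ)) * gegenbauerPoly lam (m + 1) := by
    rw [ultrasphericalOp_gegenbauerPoly]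
    simp [map_ofNat C]
  rw [hE, mul_left_comm, map_C_mul_poly, h, mul_zero] at hs
  have e : gegenbauerKernel lam (m + 1) * ultrasphericalOp lam (gegenbauerKernel lam (m + 1)) =
      gegenbauerKernel lam m * ultrasphericalOp lam (gegenbauerKernel lam m) +
      C ((m + 1 + lam) / lam) *
        (gegenbauerPoly lam (m + 1) * ultrasphericalOp lam (gegenbauerKernel lam m)) +
      C (-((m + 1) * (m + 1 + 2 * lam) * ((m + 1 + lam) / lam))) *
        (gegenbauerKernel lam m * gegenbauerPoly lam (m + 1)) +
      C (-((m + 1) * (m + 1 + 2 * lam) * ((m + 1 + lam) / lam) ^ 2)) *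
        (gegenbauerPoly lam (m + 1) * gegenbauerPoly lam (m + 1)) := by
    rw [gegenbauerKernel_succ, ultrasphericalOp_add, ultrasphericalOp_C_mul, hE]
    push_cast
    simp only [C_mul, C_pow, C_neg]
    ring
  rw [e, map_add, map_add, map_add, map_C_mul_poly, map_C_mul_poly, map_C_mul_poly, h, hs]
  ring

lemma IsUltraspherical.kernel_closed_form (hL : IsUltraspherical lam L) (hlam : 0 < lam) (m : ℕ) :
    L (gegenbauerKernel lam m * gegenbauerKernel lam m) =
        (2 * lam + 2 * m + 1) * (2 * lam + m) * (m + lam) / (2 * (2 * lam + 1) * lam ^ 2) *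
        L (gegenbauerPoly lam m * gegenbauerPoly lam m) ∧
      L (X * gegenbauerKernel lam m * gegenbauerKernel lam m) =
        (2 * m) * (2 * lam + m) * (m + lam) / (2 * (2 * lam + 1) * lam ^ 2) *
        L (gegenbauerPoly lam m * gegenbauerPoly lam m) ∧
      L (gegenbauerKernel lam m * ultrasphericalOp lam (gegenbauerKernel lam m)) =
        -(m * (m + 2 * lam + 1) * (2 * lam + 1) / (2 * lam + 3)) *
        ((2 * lam + 2 * m + 1) * (2 * lam + m) * (m + lam) / (2 * (2 * lam + 1) * lam ^ 2) *
        L (gegenbauerPoly lam m * gegenbauerPoly lam m)) := by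
  have hp1 : 2 * lam + 1 ≠ 0 := by positivity
  have hp3 : 2 * lam + 3 ≠ 0 := by positivity
  induction m with
  | zero =>
    have h0 : gegenbauerKernel lam 0 = 1 := by
      simp [gegenbauerKernel, gegenbauerPoly, hlam.ne']
    rw [h0]
    refine ⟨?_, ?_, ?_⟩
    · simp [gegenbauerPoly]
      field_simp
    · simpa [gegenbauerPoly] using
        hL.X_mul_eq_zero hlam (show 0 ≠ 0 + 1 by omega) (show 0 ≠ 0 + 1 by omega)
    · simp [ultrasphericalOp]
  | succ m ih =>
    obtain ⟨h1, h2, h3⟩ := ih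
    -- Expressing the old norm through the new one turns all three claims into identities of
    -- rational functions in `m` and `lam`.
    have hh : L (gegenbauerPoly lam m * gegenbauerPoly lam m) =
        (m + 1) * (m + 1 + lam) / ((m + lam) * (m + 2 * lam)) *
          L (gegenbauerPoly lam (m + 1) * gegenbauerPoly lam (m + 1)) := by
      have := hL.normSq_succ hlam m
      field_simp
      linear_combination -this
    rw [hL.normSq_kernel_succ hlam, hL.X_mul_kernel_succ hlam, hL.op_kernel_succ hlam, h1, h2, h3,
      hh]
    generalize L (gegenbauerPoly lam (m + 1) * gegenbauerPoly lam (m + 1)) = h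
    push_cast
    have a1 : (m : ℝ) + lam ≠ 0 := by positivity
    have a2 : (m : ℝ) + 2 * lam ≠ 0 := by positivity
    have a3 : 2 * lam + (m : ℝ) ≠ 0 := by positivity
    refine ⟨?_, ?_, ?_⟩ <;> field_simp <;> ring

end Gegenbauer

/-! ### The generating function satisfies the three-term recurrence. -/

section GeneratingFunction

open scoped ContDiff

/-- Leibniz' rule at 0, where only the term with exactly one derivative on `r` survives. -/
lemma iteratedDeriv_id_mul_zero {h : ℝ → ℝ} (hh : ContDiffAt ℝ ∞ h 0) (k : ℕ) :
    iteratedDeriv (k + 1) (fun r => r * h r) 0 = (k + 1) * iteratedDeriv k h 0 := by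
  induction k generalizing h with
  | zero =>
    have h1 : HasDerivAt (fun r => r * h r) (1 * h 0 + 0 * deriv h 0) 0 :=
      (hasDerivAt_id' (0 : ℝ)).mul (hh.differentiableAt (by simp)).hasDerivAt
    simp [h1.deriv]
  | succ k ih =>
    have hd : ContDiffAt ℝ ∞ (deriv h) 0 := hh.derivWithin le_rfl
    have hm : ContDiffAt ℝ ∞ (fun r => r * deriv h r) 0 := contDiffAt_id.mul hd
    have hev : deriv (fun r => r * h r) =ᶠ[nhds 0] h + fun r => r * deriv h r := by
      have := (hh.of_le (m := 1) (by norm_cast)).eventually (by simp)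
      filter_upwards [this] with r hr
      have h1 : HasDerivAt (fun r => r * h r) (1 * h r + r * deriv h r) r :=
        (hasDerivAt_id' r).mul (hr.differentiableAt (by simp)).hasDerivAt
      simp [h1.deriv]
    rw [iteratedDeriv_succ', hev.iteratedDeriv_eq, iteratedDeriv_add
      (hh.of_le (by norm_cast; exact le_top))
      (hm.of_le (by norm_cast; exact le_top)), ih hd, ← iteratedDeriv_succ']
    push_cast
    ring

lemma hasDerivAt_gegenbauerGeneratingFunction (lam t r : ℝ) (h : 0 < 1 - 2 * t * r + r ^ 2) :
    HasDerivAt (fun r : ℝ => (1 - 2 * t * r + r ^ 2) ^ (-lam))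
      ((-2 * t + 2 * r) * (-lam) * (1 - 2 * t * r + r ^ 2) ^ (-lam - 1)) r := by
  have h1 : HasDerivAt (fun r : ℝ => 1 - 2 * t * r + r ^ 2) (-2 * t + 2 * r) r := by
    have := (((hasDerivAt_id' r).const_mul (2 * t)).const_sub 1).add (hasDerivAt_pow 2 r)
    convert! this using 1
    simp
  exact h1.rpow_const (Or.inl h.ne')

lemma iteratedDeriv_gegenbauerGeneratingFunction (lam t : ℝ) (l : ℕ) :
    iteratedDeriv (l + 2) (fun r : ℝ => (1 - 2 * t * r + r ^ 2) ^ (-lam)) 0 =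
      2 * t * (l + 1 + lam) *
        iteratedDeriv (l + 1) (fun r : ℝ => (1 - 2 * t * r + r ^ 2) ^ (-lam)) 0 -
      (l + 1) * (l + 2 * lam) *
        iteratedDeriv l (fun r : ℝ => (1 - 2 * t * r + r ^ 2) ^ (-lam)) 0 := by
  set F : ℝ → ℝ := fun r => (1 - 2 * t * r + r ^ 2) ^ (-lam) with hF
  have hF0 : ContDiffAt ℝ ∞ F 0 :=
    ContDiffAt.rpow_const_of_ne (by fun_prop) (by norm_num)
  have hF1 : ContDiffAt ℝ ∞ (deriv F) 0 := hF0.derivWithin le_rfl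
  have hg0 : ContDiffAt ℝ ∞ (fun r => r * F r) 0 := contDiffAt_id.mul hF0
  have hg1 : ContDiffAt ℝ ∞ (fun r => r * deriv F r) 0 := contDiffAt_id.mul hF1
  have hg2 : ContDiffAt ℝ ∞ (fun r => r * (r * deriv F r)) 0 := contDiffAt_id.mul hg1
  have hs1 : ContDiffAt ℝ ∞ ((2 * t) • fun r => r * deriv F r) 0 := hg1.const_smul (2 * t)
  have hs2 : ContDiffAt ℝ ∞ ((2 * lam * t) • F) 0 := hF0.const_smul (2 * lam * t)
  have hs3 : ContDiffAt ℝ ∞ ((2 * lam) • fun r => r * F r) 0 := hg0.const_smul (2 * lam)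
  have hs4 : ContDiffAt ℝ ∞ (((2 * t) • fun r => r * deriv F r) -
    fun r => r * (r * deriv F r)) 0 := hs1.sub hg2
  have hs5 : ContDiffAt ℝ ∞ ((2 * lam * t) • F - (2 * lam) • fun r => r * F r) 0 := hs2.sub hs3
  have hpos : ∀ᶠ r : ℝ in nhds 0, 0 < 1 - 2 * t * r + r ^ 2 := by
    have : ContinuousAt (fun r : ℝ => 1 - 2 * t * r + r ^ 2) 0 := by fun_prop
    exact this.eventually (lt_mem_nhds (by norm_num))
  -- This is the differential equation `(1 - 2tr + r²) F' = 2 lam (t - r) F` solved for the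
  -- constant-coefficient term; its derivative of order `l + 1` at 0 is the recurrence. A
  -- neighbourhood of 0 suffices, so `t` may be any real number.
  have hev : deriv F =ᶠ[nhds 0] (((2 * t) • (fun r => r * deriv F r)) -
      (fun r => r * (r * deriv F r))) + (((2 * lam * t) • F) - ((2 * lam) • fun r => r * F r)) := by
    filter_upwards [hpos] with r hr
    have hd := (hasDerivAt_gegenbauerGeneratingFunction lam t r hr).deriv
    have hmul : (1 - 2 * t * r + r ^ 2) ^ (-lam - 1) * (1 - 2 * t * r + r ^ 2) = F r := by
      conv_lhs => rw [← Real.rpow_add_one hr.ne']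
      simp [hF]
    simp only [Pi.add_apply, Pi.sub_apply, Pi.smul_apply, smul_eq_mul]
    rw [← hF] at hd
    rw [hd, ← hmul]
    ring
  have le (k : ℕ) : (k : WithTop ℕ∞) ≤ ∞ := by norm_cast; exact le_top
  have hl : iteratedDeriv l (fun r => r * deriv F r) 0 = l * iteratedDeriv l F 0 := by
    cases l with
    | zero => simp
    | succ k =>
      rw [iteratedDeriv_id_mul_zero hF1, ← iteratedDeriv_succ']
      push_cast
      ring
  rw [iteratedDeriv_succ', hev.iteratedDeriv_eq, iteratedDeriv_add, iteratedDeriv_sub,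
    iteratedDeriv_sub, iteratedDeriv_const_smul, iteratedDeriv_const_smul,
    iteratedDeriv_const_smul, iteratedDeriv_id_mul_zero hF1, iteratedDeriv_id_mul_zero hg1,
    iteratedDeriv_id_mul_zero hF0, hl, ← iteratedDeriv_succ']
  · simp only [smul_eq_mul]
    ring
  · exact hg0.of_le (le _)
  · exact hF0.of_le (le _)
  · exact hg1.of_le (le _)
  · exact hs2.of_le (le _)
  · exact hs3.of_le (le _)
  · exact hs1.of_le (le _)
  · exact hg2.of_le (le _)
  · exact hs4.of_le (le _)
  · exact hs5.of_le (le _)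

lemma gegenbauer_eq_eval (lam : ℝ) (l : ℕ) (t : ℝ) :
    gegenbauer lam l t = (gegenbauerPoly lam l).eval t := by
  induction l using Nat.twoStepInduction with
  | zero => simp [gegenbauer, gegenbauerPoly]
  | one =>
    have := (hasDerivAt_gegenbauerGeneratingFunction lam t 0 (by norm_num)).deriv
    simp only [gegenbauer, iteratedDeriv_one, this, gegenbauerPoly]
    simp
    ring
  | more l h0 h1 =>
    have hr := congrArg (Polynomial.eval t) (gegenbauerPoly_recurrence lam l)
    simp only [Polynomial.eval_mul, Polynomial.eval_sub, Polynomial.eval_add, Polynomial.eval_C,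
      Polynomial.eval_natCast, Polynomial.eval_ofNat, Polynomial.eval_one, Polynomial.eval_X,
      ← h0, ← h1] at hr
    have h2 : ((l : ℝ) + 2) ≠ 0 := by positivity
    apply mul_left_cancel₀ h2
    rw [hr]
    simp only [gegenbauer]
    rw [iteratedDeriv_gegenbauerGeneratingFunction]
    have hf : ((l.factorial : ℕ) : ℝ) ≠ 0 := by positivity
    simp only [Nat.factorial_succ]
    push_cast
    field_simp
    ring

end GeneratingFunction

/-! ### Moments of the surface measure through Gaussian integrals. -/

section SphereMoments

/-- Polar coordinates separate a homogeneous function from the Gaussian. For monomials the left side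
also factors over the coordinates, which determines their sphere integrals. -/
lemma integral_exp_mul_homogeneous (n d : ℕ) (F : Ambient n → ℝ)
    (hF : ∀ r : ℝ, 0 < r → ∀ y, F (r • y) = r ^ d * F y) :
    ∫ y, F y * Real.exp (-‖y‖ ^ 2) = (∫ x : UnitSphere n, F x ∂(surfaceMeasure n)) *
      ∫ r in Set.Ioi (0 : ℝ), r ^ (n + d) * Real.exp (-r ^ 2) := by
  have hdim : Module.finrank ℝ (Ambient n) - 1 = n := by simp
  calc
    ∫ y, F y * Real.exp (-‖y‖ ^ 2)
      = ∫ y : ({(0)}ᶜ : Set (Ambient n)), F y.1 * Real.exp (-‖y.1‖ ^ 2)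
          ∂(volume.comap Subtype.val) := by
      rw [integral_subtype_comap (measurableSet_singleton _).compl
        fun y => F y * Real.exp (-‖y‖ ^ 2), restrict_compl_singleton]
    _ = ∫ x : UnitSphere n × Set.Ioi (0 : ℝ), F x.1 * (x.2.1 ^ d * Real.exp (-x.2.1 ^ 2))
          ∂(surfaceMeasure n).prod (.volumeIoiPow (Module.finrank ℝ (Ambient n) - 1)) := by
      rw [surfaceMeasure, ← (volume :
        Measure (Ambient n)).measurePreserving_homeomorphUnitSphereProd.integral_comp
        (Homeomorph.measurableEmbedding _)]
      refine integral_congr_ae (Filter.Eventually.of_forall fun y => ?_)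
      have hy : 0 < ‖y.1‖ := norm_pos_iff.2 y.2
      have h := hF ‖y.1‖ hy (‖y.1‖⁻¹ • y.1)
      rw [smul_inv_smul₀ hy.ne'] at h
      simp only [homeomorphUnitSphereProd_apply_snd_coe, homeomorphUnitSphereProd_apply_fst_coe]
      rw [h]
      ring
    _ = (∫ x : UnitSphere n, F x ∂(surfaceMeasure n)) *
        ∫ r : Set.Ioi (0 : ℝ), r.1 ^ d * Real.exp (-r.1 ^ 2)
          ∂(.volumeIoiPow (Module.finrank ℝ (Ambient n) - 1)) := by
      have : SFinite (surfaceMeasure n) := by unfold surfaceMeasure; infer_instance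
      exact integral_prod_mul (fun x : UnitSphere n => F x)
        (fun r : Set.Ioi (0 : ℝ) => r.1 ^ d * Real.exp (-r.1 ^ 2))
    _ = _ := by
      congr 1
      simp only [Measure.volumeIoiPow, ENNReal.ofReal, hdim]
      rw [integral_withDensity_eq_integral_smul,
        integral_subtype_comap measurableSet_Ioi
          fun a : ℝ => Real.toNNReal (a ^ n) • (a ^ d * Real.exp (-a ^ 2)),
        setIntegral_congr_fun measurableSet_Ioi fun x hx => ?_]
      · simp only [NNReal.smul_def]
        rw [Real.coe_toNNReal _ (pow_nonneg (le_of_lt hx) _), smul_eq_mul, pow_add, mul_assoc]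
      · exact (measurable_subtype_coe.pow_const _).real_toNNReal

lemma integral_Ioi_pow_mul_exp (k : ℕ) :
    ∫ r in Set.Ioi (0 : ℝ), r ^ k * Real.exp (-r ^ 2) = 1 / 2 * Real.Gamma ((k + 1) / 2) := by
  have h := integral_rpow_mul_exp_neg_rpow (p := 2) (q := k) (by norm_num)
    (by have : (0 : ℝ) ≤ k := by positivity
        linarith)
  rw [← h]
  refine setIntegral_congr_fun measurableSet_Ioi fun x _ => ?_
  simp only [Real.rpow_natCast, Real.rpow_two]

lemma integral_Ioi_pow_mul_exp_pos (k : ℕ) :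
    0 < ∫ r in Set.Ioi (0 : ℝ), r ^ k * Real.exp (-r ^ 2) := by
  rw [integral_Ioi_pow_mul_exp]
  have := Real.Gamma_pos_of_pos (show (0 : ℝ) < (k + 1) / 2 by positivity)
  positivity

lemma integral_Ioi_pow_add_two_mul_exp (k : ℕ) :
    ∫ r in Set.Ioi (0 : ℝ), r ^ (k + 2) * Real.exp (-r ^ 2) =
      (k + 1) / 2 * ∫ r in Set.Ioi (0 : ℝ), r ^ k * Real.exp (-r ^ 2) := by
  rw [integral_Ioi_pow_mul_exp, integral_Ioi_pow_mul_exp]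
  have h := Real.Gamma_add_one (s := ((k : ℝ) + 1) / 2) (by positivity)
  rw [show ((k + 2 : ℕ) + 1 : ℝ) / 2 = (k + 1) / 2 + 1 by push_cast; ring, h]
  ring

lemma integrable_pow_mul_exp_neg_sq (k : ℕ) :
    Integrable (fun y : ℝ => y ^ k * Real.exp (-y ^ 2)) := by
  have h := integrable_rpow_mul_exp_neg_mul_sq (b := 1) one_pos (s := k)
    (by have : (0 : ℝ) ≤ k := by positivity
        linarith)
  simpa using h

lemma integral_pow_add_two_mul_exp (k : ℕ) :
    ∫ y : ℝ, y ^ (k + 2) * Real.exp (-y ^ 2) =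
      (k + 1) / 2 * ∫ y : ℝ, y ^ k * Real.exp (-y ^ 2) := by
  have hd (y : ℝ) : HasDerivAt (fun y : ℝ => y ^ (k + 1) * Real.exp (-y ^ 2))
      ((k + 1) * (y ^ k * Real.exp (-y ^ 2)) - 2 * (y ^ (k + 2) * Real.exp (-y ^ 2))) y := by
    have := (hasDerivAt_pow (k + 1) y).mul (hasDerivAt_pow 2 y).fun_neg.exp
    convert! this using 1
    push_cast
    ring
  have h1 := (integrable_pow_mul_exp_neg_sq k).const_mul ((k : ℝ) + 1)
  have h2 := (integrable_pow_mul_exp_neg_sq (k + 2)).const_mul (2 : ℝ)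
  have h := integral_eq_zero_of_hasDerivAt_of_integrable hd (h1.sub h2)
    (integrable_pow_mul_exp_neg_sq (k + 1))
  rw [integral_sub h1 h2, integral_const_mul, integral_const_mul] at h
  linarith

lemma integral_id_mul_exp : ∫ y : ℝ, y ^ 1 * Real.exp (-y ^ 2) = 0 := by
  have h := integral_neg_eq_self (fun y : ℝ => y ^ 1 * Real.exp (-y ^ 2)) volume
  have h2 : ∫ y : ℝ, (-y) ^ 1 * Real.exp (-(-y) ^ 2) = -∫ y : ℝ, y ^ 1 * Real.exp (-y ^ 2) := by
    rw [← integral_neg]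
    congr 1
    ext y
    simp
  rw [h2] at h
  linarith

lemma integral_monomial_mul_exp (n : ℕ) (a : Fin (n + 1) → ℕ) :
    ∫ y : Ambient n, (∏ i, y i ^ a i) * Real.exp (-‖y‖ ^ 2) =
      ∏ i, ∫ t : ℝ, t ^ a i * Real.exp (-t ^ 2) := by
  rw [← integral_fintype_prod_volume_eq_prod fun i t => t ^ a i * Real.exp (-t ^ 2),
    ← (EuclideanSpace.volume_preserving_symm_measurableEquiv_toLp (Fin (n + 1))).integral_comp
      (MeasurableEquiv.measurableEmbedding _)]
  congr 1
  ext y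
  rw [Finset.prod_mul_distrib, ← Real.exp_sum, EuclideanSpace.norm_sq_eq, Finset.sum_neg_distrib]
  simp

lemma integral_sphere_monomial (n : ℕ) (a : Fin (n + 1) → ℕ) :
    (∫ x : UnitSphere n, ∏ i, (x : Ambient n) i ^ a i ∂(surfaceMeasure n)) *
      ∫ r in Set.Ioi (0 : ℝ), r ^ (n + ∑ i, a i) * Real.exp (-r ^ 2) =
      ∏ i, ∫ t : ℝ, t ^ a i * Real.exp (-t ^ 2) := by
  rw [← integral_monomial_mul_exp, integral_exp_mul_homogeneous n (∑ i, a i)]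
  intro r _ y
  simp only [PiLp.smul_apply, smul_eq_mul, mul_pow, Finset.prod_mul_distrib,
    Finset.prod_pow_eq_pow_sum]

lemma integral_sphere_monomial_eq_zero (n : ℕ) (a : Fin (n + 1) → ℕ) (j : Fin (n + 1))
    (hj : a j = 1) :
    ∫ x : UnitSphere n, ∏ i, (x : Ambient n) i ^ a i ∂(surfaceMeasure n) = 0 := by
  have h := integral_sphere_monomial n a
  rw [Finset.prod_eq_zero (Finset.mem_univ j) (by rw [hj]; exact integral_id_mul_exp)] at h
  exact (mul_eq_zero.1 h).resolve_right (integral_Ioi_pow_mul_exp_pos _).ne'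

lemma integral_sphere_pow_mul (n k : ℕ) :
    (∫ x : UnitSphere n, (x : Ambient n) 0 ^ k ∂(surfaceMeasure n)) *
      ∫ r in Set.Ioi (0 : ℝ), r ^ (n + k) * Real.exp (-r ^ 2) =
      (∫ t : ℝ, t ^ k * Real.exp (-t ^ 2)) * (∫ t : ℝ, t ^ 0 * Real.exp (-t ^ 2)) ^ n := by
  have h := integral_sphere_monomial n (Fin.cons k fun _ => 0)
  simpa [Fin.prod_univ_succ, Fin.sum_univ_succ] using h

/-- Raising the exponent by two multiplies the line integral by `(k + 1) / 2` and the radial one by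
`(n + k + 1) / 2`. -/
lemma integral_sphere_pow_add_two (n k : ℕ) :
    (n + k + 1) * ∫ x : UnitSphere n, (x : Ambient n) 0 ^ (k + 2) ∂(surfaceMeasure n) =
      (k + 1) * ∫ x : UnitSphere n, (x : Ambient n) 0 ^ k ∂(surfaceMeasure n) := by
  have h1 := integral_sphere_pow_mul n k
  have h2 := integral_sphere_pow_mul n (k + 2)
  rw [integral_pow_add_two_mul_exp, ← add_assoc, integral_Ioi_pow_add_two_mul_exp, mul_assoc,
    ← h1] at h2
  have hp := integral_Ioi_pow_mul_exp_pos (n + k)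
  apply mul_right_cancel₀ hp.ne'
  push_cast at h2
  linear_combination 2 * h2

lemma integral_sphere_coord (n : ℕ) :
    ∫ x : UnitSphere n, (x : Ambient n) 0 ∂(surfaceMeasure n) = 0 := by
  have h := integral_sphere_monomial_eq_zero n (Fin.cons 1 fun _ => 0) 0 rfl
  simpa [Fin.prod_univ_succ] using h

lemma integral_sphere_pow_mul_coord (n k : ℕ) (j : Fin n) :
    ∫ x : UnitSphere n, (x : Ambient n) 0 ^ k * (x : Ambient n) j.succ ∂(surfaceMeasure n) = 0 := by
  have h := integral_sphere_monomial_eq_zero n (Fin.cons k (Pi.single j 1)) j.succ (by simp)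
  rw [← h]
  congr 1
  ext x
  rw [Fin.prod_univ_succ, Finset.prod_eq_single j]
  · simp
  · intro i _ hi
    simp [hi]
  · simp

instance surfaceMeasure_isFiniteMeasure (n : ℕ) : IsFiniteMeasure (surfaceMeasure n) := by
  unfold surfaceMeasure
  infer_instance

lemma integrable_sphere_of_continuous {n : ℕ} {E : Type*} [NormedAddCommGroup E]
    {f : UnitSphere n → E} (hf : Continuous f) : Integrable f (surfaceMeasure n) :=
  hf.integrable_of_hasCompactSupport (HasCompactSupport.of_compactSpace f)

open Polynomial

@[fun_prop]
lemma continuous_sphere_eval (n : ℕ) (p : ℝ[X]) :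
    Continuous fun x : UnitSphere n => p.eval ((x : Ambient n) 0) := by
  fun_prop

/-- The functional `p ↦ ∫ p(x_0) dσ(x)` over the sphere. -/
noncomputable def sphereFunctional (n : ℕ) : ℝ[X] →ₗ[ℝ] ℝ where
  toFun p := ∫ x : UnitSphere n, p.eval ((x : Ambient n) 0) ∂(surfaceMeasure n)
  map_add' p q := by
    simp only [eval_add]
    exact integral_add (integrable_sphere_of_continuous (continuous_sphere_eval n p))
      (integrable_sphere_of_continuous (continuous_sphere_eval n q))
  map_smul' a p := by
    simp only [eval_smul, smul_eq_mul, integral_const_mul, RingHom.id_apply]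

lemma sphereFunctional_apply (n : ℕ) (p : ℝ[X]) : sphereFunctional n p =
    ∫ x : UnitSphere n, p.eval ((x : Ambient n) 0) ∂(surfaceMeasure n) := rfl

lemma sphereFunctional_one_pos (n : ℕ) : 0 < sphereFunctional n 1 := by
  have : NeZero (surfaceMeasure n) := ⟨Measure.toSphere_ne_zero _⟩
  simp [sphereFunctional_apply]

/-- By linearity monomials suffice: since `2 * lam + 1 = n`, degree `k + 1` is exactly the moment
recursion, and degree 0 is the vanishing of the first moment of `x_1`. -/
lemma sphereFunctional_isUltraspherical (n : ℕ) (lam : ℝ) (hlam : lam = ((n : ℝ) - 1) / 2) :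
    IsUltraspherical lam (sphereFunctional n) := by
  have hn : 2 * lam + 1 = n := by rw [hlam]; ring
  intro g
  induction g using Polynomial.induction_on' with
  | add p q hp hq =>
    have e : (1 - X ^ 2) * derivative (p + q) - (2 * C lam + 1) * X * (p + q) =
        ((1 - X ^ 2) * derivative p - (2 * C lam + 1) * X * p) +
        ((1 - X ^ 2) * derivative q - (2 * C lam + 1) * X * q) := by
      rw [derivative_add]
      ring
    rw [e, map_add, hp, hq, add_zero]
  | monomial k a =>
    have hC : (2 * C lam + 1 : ℝ[X]) = C (n : ℝ) := by rw [← hn]; simp [map_ofNat C]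
    rw [← C_mul_X_pow_eq_monomial, hC]
    cases k with
    | zero =>
      have e : (1 - X ^ 2) * derivative (C a * X ^ 0) - C (n : ℝ) * X * (C a * X ^ 0) =
        C (-n * a) * X := by simp; ring
      rw [e, map_C_mul_poly, sphereFunctional_apply]
      simp [integral_sphere_coord]
    | succ k =>
      have e : (1 - X ^ 2) * derivative (C a * X ^ (k + 1)) - C (n : ℝ) * X * (C a * X ^ (k + 1)) =
        C (a * (k + 1)) * X ^ k - C (a * (n + k + 1)) * X ^ (k + 2) := by
        simp; ring
      rw [e, map_sub, map_C_mul_poly, map_C_mul_poly, sphereFunctional_apply,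
        sphereFunctional_apply]
      simp only [eval_pow, eval_X]
      linear_combination (-a) * integral_sphere_pow_add_two n k

lemma integral_sphere_eval_mul_coord (n : ℕ) (j : Fin n) (p : ℝ[X]) :
    ∫ x : UnitSphere n, p.eval ((x : Ambient n) 0) * (x : Ambient n) j.succ
      ∂(surfaceMeasure n) = 0 := by
  induction p using Polynomial.induction_on' with
  | add p q hp hq =>
    simp only [eval_add, add_mul]
    rw [integral_add (integrable_sphere_of_continuous (by fun_prop))
      (integrable_sphere_of_continuous (by fun_prop)), hp, hq, add_zero]
  | monomial k a =>
    simp only [eval_monomial, mul_assoc, integral_const_mul, integral_sphere_pow_mul_coord,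
      mul_zero]

end SphereMoments

/-! ### The Laplace–Beltrami operator on zonal functions. -/

section LaplaceBeltrami

lemma iteratedFDeriv_two_apply_eq_deriv_deriv {E F : Type*} [NormedAddCommGroup E]
    [NormedSpace ℝ E] [NormedAddCommGroup F] [NormedSpace ℝ F] {f : E → F} {x : E}
    (hf : ContDiffAt ℝ 2 f x) (v : E) :
    iteratedFDeriv ℝ 2 f x ![v, v] = deriv (deriv fun s : ℝ => f (x + s • v)) 0 := by
  have hline (s : ℝ) : HasDerivAt (fun s : ℝ => x + s • v) v s := by
    simpa using ((hasDerivAt_id' s).smul_const v).const_add x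
  have hcont : Filter.Tendsto (fun s : ℝ => x + s • v) (nhds 0) (nhds x) := by
    have : ContinuousAt (fun s : ℝ => x + s • v) 0 := by fun_prop
    simpa [ContinuousAt] using this
  have hev : (deriv fun s : ℝ => f (x + s • v)) =ᶠ[nhds 0]
      fun s => fderiv ℝ f (x + s • v) v := by
    filter_upwards [hcont.eventually (hf.eventually (by simp))] with s hs
    exact ((hs.differentiableAt (by simp)).hasFDerivAt.comp_hasDerivAt s (hline s)).deriv
  have hd : DifferentiableAt ℝ (fderiv ℝ f) x :=
    (hf.fderiv_right (m := 1) (by norm_num)).differentiableAt (by simp)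
  have h0 : HasFDerivAt (fderiv ℝ f) (fderiv ℝ (fderiv ℝ f) x) (x + (0 : ℝ) • v) := by
    simpa using hd.hasFDerivAt
  have h1 : HasDerivAt (fun s : ℝ => fderiv ℝ f (x + s • v)) (fderiv ℝ (fderiv ℝ f) x v) 0 :=
    h0.comp_hasDerivAt (0 : ℝ) (hline 0)
  have h2 : HasDerivAt (fun s : ℝ => fderiv ℝ f (x + s • v) v) (fderiv ℝ (fderiv ℝ f) x v v) 0 :=
    ((ContinuousLinearMap.apply ℝ F v).hasFDerivAt).comp_hasDerivAt (0 : ℝ) h1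
  rw [hev.deriv_eq, iteratedFDeriv_two_apply, h2.deriv]
  rfl

/-- For unit vectors `x`, `v` with inner product `b`, the square root is `‖x + s • v‖`, so this is
the second derivative of the radially constant extension along `v`. -/
lemma deriv_deriv_eval_div_sqrt (p : Polynomial ℝ) (x₀ v₀ b : ℝ) :
    deriv (deriv fun s : ℝ => p.eval ((x₀ + s * v₀) * (√(1 + 2 * b * s + s ^ 2))⁻¹)) 0 =
      p.derivative.derivative.eval x₀ * (v₀ - x₀ * b) ^ 2 +
      p.derivative.eval x₀ * (-2 * v₀ * b + x₀ * (3 * b ^ 2 - 1)) := by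
  set N : ℝ → ℝ := fun s => (√(1 + 2 * b * s + s ^ 2))⁻¹ with hN
  have hN0 : N 0 = 1 := by simp [hN]
  have hpos : ∀ᶠ s : ℝ in nhds 0, 0 < 1 + 2 * b * s + s ^ 2 := by
    have : ContinuousAt (fun s : ℝ => 1 + 2 * b * s + s ^ 2) 0 := by fun_prop
    exact this.eventually (lt_mem_nhds (by norm_num))
  have hNd (s : ℝ) (hs : 0 < 1 + 2 * b * s + s ^ 2) : HasDerivAt N (-(b + s) * N s ^ 3) s := by
    have h1 : HasDerivAt (fun s : ℝ => 1 + 2 * b * s + s ^ 2) (2 * b + 2 * s) s := by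
      have := (((hasDerivAt_id' s).const_mul (2 * b)).const_add 1).add (hasDerivAt_pow 2 s)
      convert! this using 1
      simp
    have hq : √(1 + 2 * b * s + s ^ 2) ≠ 0 := (Real.sqrt_pos.2 hs).ne'
    convert! (h1.sqrt hs.ne').inv hq using 1
    simp only [hN]
    field_simp
  have hu (s : ℝ) (hs : 0 < 1 + 2 * b * s + s ^ 2) : HasDerivAt (fun s => (x₀ + s * v₀) * N s)
      (v₀ * N s - (x₀ + s * v₀) * (b + s) * N s ^ 3) s := by
    convert! (((hasDerivAt_id' s).mul_const v₀).const_add x₀).mul (hNd s hs) using 1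
    ring
  have hev : (deriv fun s => p.eval ((x₀ + s * v₀) * N s)) =ᶠ[nhds 0] fun s =>
      p.derivative.eval ((x₀ + s * v₀) * N s) *
        (v₀ * N s - (x₀ + s * v₀) * (b + s) * N s ^ 3) := by
    filter_upwards [hpos] with s hs
    exact ((p.hasDerivAt _).comp s (hu s hs)).deriv
  rw [hev.deriv_eq]
  have h0 := hNd 0 (by norm_num)
  have h1 := (p.derivative.hasDerivAt _).comp (0 : ℝ) (hu 0 (by norm_num))
  have hlin : HasDerivAt (fun s : ℝ => (x₀ + s * v₀) * (b + s)) (v₀ * b + x₀) 0 := by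
    convert! (((hasDerivAt_id' (0 : ℝ)).mul_const v₀).const_add x₀).mul
      ((hasDerivAt_id' (0 : ℝ)).const_add b) using 1
    ring
  have h2 := (h0.const_mul v₀).sub (hlin.mul (h0.pow 3))
  have h3 := (h1.mul h2).deriv
  simp only [Function.comp_def] at h3
  refine Eq.trans h3 ?_
  simp [hN0]
  ring

lemma contDiffAt_eval_div_norm (n : ℕ) (p : Polynomial ℝ) {y : Ambient n} (hy : y ≠ 0) :
    ContDiffAt ℝ 2 (fun y : Ambient n => p.eval (y 0 * ‖y‖⁻¹)) y := by
  have hp : ContDiff ℝ 2 fun t : ℝ => p.eval t := p.contDiff_aeval 2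
  have h0 : ContDiffAt ℝ 2 (fun y : Ambient n => y 0) y :=
    (EuclideanSpace.proj (𝕜 := ℝ) (0 : Fin (n + 1))).contDiff.contDiffAt
  exact hp.contDiffAt.comp y
    (h0.mul ((contDiffAt_norm ℝ hy).inv (norm_ne_zero_iff.2 hy)))

lemma laplacian_eval_div_norm (n : ℕ) (p : Polynomial ℝ) (x : UnitSphere n) (lam : ℝ)
    (hlam : lam = ((n : ℝ) - 1) / 2) :
    Laplacian.laplacian (fun y : Ambient n => p.eval (y 0 * ‖y‖⁻¹)) (x : Ambient n) =
      (ultrasphericalOp lam p).eval ((x : Ambient n) 0) := by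
  have hx : ‖(x : Ambient n)‖ = 1 := by simp
  have hx0 : (x : Ambient n) ≠ 0 := by
    rw [← norm_ne_zero_iff, hx]
    exact one_ne_zero
  rw [InnerProductSpace.laplacian_eq_iteratedFDeriv_orthonormalBasis _
    (EuclideanSpace.basisFun (Fin (n + 1)) ℝ)]
  have hterm (i : Fin (n + 1)) : iteratedFDeriv ℝ 2
      (fun y : Ambient n => p.eval (y 0 * ‖y‖⁻¹)) (x : Ambient n)
      ![EuclideanSpace.basisFun (Fin (n + 1)) ℝ i, EuclideanSpace.basisFun (Fin (n + 1)) ℝ i] =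
      p.derivative.derivative.eval ((x : Ambient n) 0) *
        ((if i = 0 then 1 else 0) - (x : Ambient n) 0 * (x : Ambient n) i) ^ 2 +
      p.derivative.eval ((x : Ambient n) 0) * (-2 * (if i = 0 then 1 else 0) * (x : Ambient n) i +
        (x : Ambient n) 0 * (3 * (x : Ambient n) i ^ 2 - 1)) := by
    rw [iteratedFDeriv_two_apply_eq_deriv_deriv (contDiffAt_eval_div_norm n p hx0),
      ← deriv_deriv_eval_div_sqrt]
    congr 2
    ext s
    congr 1
    have hnorm : ‖(x : Ambient n) + s • EuclideanSpace.basisFun (Fin (n + 1)) ℝ i‖ =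
        √(1 + 2 * (x : Ambient n) i * s + s ^ 2) := by
      rw [← Real.sqrt_sq (norm_nonneg _), norm_add_sq_real, hx, inner_smul_right, norm_smul]
      congr 1
      simp [EuclideanSpace.inner_single_right]
      ring
    rw [hnorm]
    simp [EuclideanSpace.basisFun_apply, eq_comm]
  simp only [hterm]
  have hsum : ∑ i, (x : Ambient n) i ^ 2 = 1 := by
    have := EuclideanSpace.norm_sq_eq (x : Ambient n)
    simpa [hx] using this.symm
  have hn : (n : ℝ) = 2 * lam + 1 := by rw [hlam]; ring
  -- Separating the contribution of the pole leaves sums that need only `∑ x_i² = 1`.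
  have e1 (i : Fin (n + 1)) : ((if i = 0 then (1 : ℝ) else 0) -
      (x : Ambient n) 0 * (x : Ambient n) i) ^ 2 =
      (if i = 0 then 1 - 2 * (x : Ambient n) 0 ^ 2 else 0) +
      (x : Ambient n) 0 ^ 2 * (x : Ambient n) i ^ 2 := by
    split_ifs with h
    · subst h; ring
    · ring
  have e2 (i : Fin (n + 1)) : -2 * (if i = 0 then (1 : ℝ) else 0) * (x : Ambient n) i +
        (x : Ambient n) 0 * (3 * (x : Ambient n) i ^ 2 - 1) =
      (if i = 0 then -2 * (x : Ambient n) 0 else 0) +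
        ((3 * (x : Ambient n) 0) * (x : Ambient n) i ^ 2 - (x : Ambient n) 0) := by
    split_ifs with h
    · subst h; ring
    · ring
  rw [Finset.sum_add_distrib, ← Finset.mul_sum, ← Finset.mul_sum]
  simp only [e1, e2, Finset.sum_add_distrib, Finset.sum_sub_distrib, ← Finset.mul_sum, hsum,
    Finset.sum_ite_eq', Finset.mem_univ, if_true, Finset.sum_const, Finset.card_univ,
    Fintype.card_fin, nsmul_eq_mul]
  push_cast
  rw [hn]
  simp [ultrasphericalOp]
  ring

lemma laplaceBeltrami_zonal (n : ℕ) (p : Polynomial ℝ) (c : ℂ) (x : UnitSphere n) (lam : ℝ)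
    (hlam : lam = ((n : ℝ) - 1) / 2) :
    laplaceBeltrami (fun x : UnitSphere n => c * ((p.eval ((x : Ambient n) 0) : ℝ) : ℂ)) x =
      c * (((ultrasphericalOp lam p).eval ((x : Ambient n) 0) : ℝ) : ℂ) := by
  have hx0 : (x : Ambient n) ≠ 0 := ne_zero_of_mem_unit_sphere x
  -- The Laplacian commutes with real-linear maps, which reduces the complex multiple to the real
  -- polynomial.
  let T : ℝ →L[ℝ] ℂ := ContinuousLinearMap.toSpanSingleton ℝ c
  have hT (t : ℝ) : T t = c * t := by simp [T, mul_comm]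
  have hev : radialExtension (fun x : UnitSphere n => c * ((p.eval ((x : Ambient n) 0) : ℝ) : ℂ))
      =ᶠ[nhds (x : Ambient n)] T ∘ fun y : Ambient n => p.eval (y 0 * ‖y‖⁻¹) := by
    filter_upwards [isOpen_ne.mem_nhds hx0] with y hy
    have hy' : y ≠ 0 := hy
    rw [radialExtension, dif_neg hy', Function.comp_apply, hT]
    simp [mul_comm]
  rw [laplaceBeltrami, (InnerProductSpace.laplacian_congr_nhds hev).eq_of_nhds,
    (contDiffAt_eval_div_norm n p hx0).laplacian_CLM_comp_left, Function.comp_apply,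
    laplacian_eval_div_norm n p x lam hlam, hT]

end LaplaceBeltrami

/-! ### Integrals of zonal functions, and the theorem. -/

section Zonal

open Polynomial

lemma scalingKernel_eq (n m : ℕ) (c : ℂ) (lam : ℝ) (hlam : lam = ((n : ℝ) - 1) / 2) :
    scalingKernel n m c = fun x : UnitSphere n =>
      c * (((gegenbauerKernel lam m).eval ((x : Ambient n) 0) : ℝ) : ℂ) := by
  ext x
  simp only [scalingKernel, gegenbauerKernel, eval_finsetSum, eval_mul, eval_C, ← hlam,
    gegenbauer_eq_eval]

lemma contMDiff_zonal (n : ℕ) (p : ℝ[X]) (c : ℂ) : ContMDiff (𝓡 n) 𝓘(ℝ, ℂ) 2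
    (fun x : UnitSphere n => c * ((p.eval ((x : Ambient n) 0) : ℝ) : ℂ)) := by
  have h0 : ContDiff ℝ 2 fun y : Ambient n => y 0 :=
    (EuclideanSpace.proj (𝕜 := ℝ) (0 : Fin (n + 1))).contDiff
  have h : ContDiff ℝ 2 fun y : Ambient n => c * ((p.eval (y 0) : ℝ) : ℂ) :=
    contDiff_const.mul (Complex.ofRealCLM.contDiff.comp ((p.contDiff_aeval 2).comp h0))
  exact h.contMDiff.comp contMDiff_coe_sphere

lemma normSq_zonal (n : ℕ) (p : ℝ[X]) (c : ℂ) (x : UnitSphere n) :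
    ‖c * ((p.eval ((x : Ambient n) 0) : ℝ) : ℂ)‖ ^ 2 = ‖c‖ ^ 2 * (p * p).eval ((x : Ambient n) 0) := by
  rw [norm_mul, mul_pow, Complex.norm_real, Real.norm_eq_abs, sq_abs, eval_mul, sq (eval _ p)]

lemma integral_normSq_zonal (n : ℕ) (p : ℝ[X]) (c : ℂ) :
    ∫ x : UnitSphere n, ‖c * ((p.eval ((x : Ambient n) 0) : ℝ) : ℂ)‖ ^ 2 ∂(surfaceMeasure n) =
      ‖c‖ ^ 2 * sphereFunctional n (p * p) := by
  simp only [normSq_zonal, integral_const_mul, sphereFunctional_apply]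

lemma firstMoment_zonal (n : ℕ) (p : ℝ[X]) (c : ℂ) :
    firstMoment (fun x : UnitSphere n => c * ((p.eval ((x : Ambient n) 0) : ℝ) : ℂ)) =
      EuclideanSpace.single 0 (‖c‖ ^ 2 * sphereFunctional n (X * p * p)) := by
  ext i
  have hint : Integrable (fun x : UnitSphere n =>
      (‖c * ((p.eval ((x : Ambient n) 0) : ℝ) : ℂ)‖ ^ 2) • (x : Ambient n)) (surfaceMeasure n) :=
    integrable_sphere_of_continuous (by fun_prop)
  have h := (EuclideanSpace.proj (𝕜 := ℝ) i).integral_comp_comm hint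
  simp only [PiLp.proj_apply, PiLp.smul_apply, smul_eq_mul, normSq_zonal] at h
  rw [firstMoment]
  simp only [normSq_zonal]
  rw [← h]
  simp only [mul_assoc, integral_const_mul]
  refine Fin.cases ?_ (fun j => ?_) i
  · simp only [sphereFunctional_apply, PiLp.single_apply, if_true]
    congr 2
    ext x
    simp
    ring
  · rw [integral_sphere_eval_mul_coord]
    simp

lemma integral_laplaceBeltrami_zonal (n : ℕ) (p : ℝ[X]) (c : ℂ) (lam : ℝ)
    (hlam : lam = ((n : ℝ) - 1) / 2) :
    ∫ x : UnitSphere n,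
      laplaceBeltrami (fun x : UnitSphere n => c * ((p.eval ((x : Ambient n) 0) : ℝ) : ℂ)) x *
        conj (c * ((p.eval ((x : Ambient n) 0) : ℝ) : ℂ)) ∂(surfaceMeasure n) =
      ((‖c‖ ^ 2 * sphereFunctional n (p * ultrasphericalOp lam p) : ℝ) : ℂ) := by
  rw [sphereFunctional_apply, ← integral_const_mul, ← integral_complex_ofReal]
  congr 1
  ext x
  rw [laplaceBeltrami_zonal n p c x lam hlam]
  push_cast
  rw [← Complex.mul_conj', eval_mul, map_mul, Complex.conj_ofReal]
  push_cast
  ring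

end Zonal

theorem mainTheorem6 (n m : ℕ) (hn : 2 ≤ n) (hm : 1 ≤ m) (c : ℂ) (hc : c ≠ 0)
    (lam : ℝ) (hlam : lam = ((n : ℝ) - 1) / 2) :
    ContMDiff (𝓡 n) 𝓘(ℝ, ℂ) 2 (scalingKernel n m c) ∧
    firstMoment (scalingKernel n m c) ≠ 0 ∧
    varSpace (scalingKernel n m c) = ((2 * (m : ℝ) + 2 * lam + 1) / (2 * (m : ℝ))) ^ 2 - 1 ∧
    varMomentum (scalingKernel n m c) =
      (((m : ℝ) * ((m : ℝ) + 2 * lam + 1) * (2 * lam + 1) / (2 * lam + 3) : ℝ) : ℂ) := by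
  have hlam0 : 0 < lam := by
    have : (2 : ℝ) ≤ n := by exact_mod_cast hn
    rw [hlam]
    linarith
  have hm0 : (0 : ℝ) < m := by exact_mod_cast hm
  have hL := sphereFunctional_isUltraspherical n lam hlam
  obtain ⟨hA, hB, hG⟩ := hL.kernel_closed_form hlam0 m
  have hh := hL.normSq_pos hlam0 (sphereFunctional_one_pos n) m
  rw [scalingKernel_eq n m c lam hlam, varSpace, varMomentum, integral_normSq_zonal,
    firstMoment_zonal, integral_laplaceBeltrami_zonal n _ c lam hlam, hG, hB, hA]
  generalize sphereFunctional n (gegenbauerPoly lam m * gegenbauerPoly lam m) = h at hh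
  have hc0 : 0 < ‖c‖ := norm_pos_iff.2 hc
  -- Positivity of the polar coordinate, where `1 ≤ m` enters, gives the nonvanishing of the first
  -- moment and also removes the absolute value in its norm.
  have hBpos : 0 < ‖c‖ ^ 2 *
      ((2 * m) * (2 * lam + m) * (m + lam) / (2 * (2 * lam + 1) * lam ^ 2) * h) := by positivity
  refine ⟨contMDiff_zonal n _ c, ?_, ?_, ?_⟩
  · rw [Ne, PiLp.single_eq_zero_iff]
    exact hBpos.ne'
  · rw [PiLp.norm_single, Real.norm_of_nonneg hBpos.le]
    congr 2
    field_simp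
    ring
  · rw [← Complex.ofReal_div, ← Complex.ofReal_neg]
    congr 1
    field_simp
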